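/- Let $M$ be a set of $n$ men and $W$ a set of $n$ women. A preference profile $\succ$ gives each man $m$ a strict total order $\succ_m$ on $W$ and each woman $w$ a strict total order $\succ_w$ on $M$. We write $x \succeq_a y$ for "$x \succ_a y$ or $x = y$". A matching $\mu$ is a bijection between $M$ and $W$; we write $\mu(m)$ and $\mu(w)$ for the partners of $m$ and $w$. It is stable with respect to $\succ$ if there is no pair $(m,w)$ with $w \succ_m \mu(m)$ and $m \succ_w \mu(w)$. We write $\mu \succeq_W \mu'$ if $\mu(w) \succeq_w \mu'(w)$ for all $w \in W$. Let $\mathrm{DA}(\succ)$ denote the matching computed by the men-proposing deferred acceptance algorithm on $\succ$: in each round, every unmatched man proposes to his favourite woman among those who have not rejected him yet, and each woman tentatively accepts her favourite among the new proposers and the man she holds, and rejects the others, until no further proposals can be made. Fix a true profile $\succ$ and a man $m \in M$ (the accomplice), and let $\mu := \mathrm{DA}(\succ)$. For a strict total order $\succ'_m$ on $W$ (a misreport of $m$), let $\mu' := \mathrm{DA}(\succ_{-m}, \succ'_m)$ be the matching computed when $m$ reports $\succ'_m$ and all other agents report truthfully. The misreport is no-regret if $\mu'(m) \succeq_m \mu(m)$.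 A no-regret misreport $\succ'_m$ is an optimal one-for-all strategy for the accomplice if $\mu' \succeq_W \mu$ and, for every no-regret misreport $\succ''_m$ with $\mu'' := \mathrm{DA}(\succ_{-m}, \succ''_m)$, we have $\mu' \succeq_W \mu''$. Then an optimal one-for-all strategy for the accomplice exists, and every optimal one-for-all strategy $\succ'_m$ is stability-preserving: the manipulated matching $\mathrm{DA}(\succ_{-m}, \succ'_m)$ is stable with respect to the true preferences $\succ$. -/

import Mathlib

namespace OneForAll

universe u v

/-- A preference list over `α`: a strict total order, `L.prefers a b` meaning that `a` is
ranked strictly above `b`. -/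
structure PrefList (α : Type u) where
  prefers : α → α → Prop
  isStrictTotalOrder : IsStrictTotalOrder α prefers

/-- `a` is weakly preferred to `b`: either `a` is ranked above `b`, or `a = b`. -/
def PrefList.weaklyPrefers {α : Type u} (L : PrefList α) (a b : α) : Prop :=
  L.prefers a b ∨ a = b

/-- `a` is the favourite element of `S` according to `L`. -/
def PrefList.IsFavourite {α : Type u} (L : PrefList α) (S : Set α) (a : α) : Prop :=
  a ∈ S ∧ ∀ b ∈ S, b ≠ a → L.prefers a b

/-- The favourite element of `S`, or `none` if there is none (for finite `α`: if `S` is empty). -/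
noncomputable def PrefList.favourite {α : Type u} (L : PrefList α) (S : Set α) : Option α :=
  open Classical in if h : ∃ a, L.IsFavourite S a then some h.choose else none

/-- A preference profile: a list over the women for each man, a list over the men for each woman. -/
structure Profile (M : Type u) (W : Type v) where
  men : M → PrefList W
  women : W → PrefList M

/-- The profile in which man `m` reports the list `L` and all other agents keep their lists. -/
noncomputable def Profile.withMan {M : Type u} {W : Type v} (P : Profile M W) (m : M)
    (L : PrefList W) : Profile M W where
  men := open Classical in Function.update P.men m L
  women := P.women

/-- State of deferred acceptance between two rounds: the proposal that each woman tentatively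
holds, and the relation "woman `w` has rejected man `m`". -/
structure DAState (M : Type u) (W : Type v) where
  held : W → Option M
  rejected : M → W → Prop

section DA

variable {M : Type u} {W : Type v}

/-- Initially no proposal is held and nobody has been rejected. -/
def DAState.init (M : Type u) (W : Type v) : DAState M W where
  held := fun _ => none
  rejected := fun _ _ => False

/-- Man `m` is currently unmatched. -/
def DAState.Unmatched (s : DAState M W) (m : M) : Prop := ∀ w, s.held w ≠ some m

/-- Proposal phase: man `m` is unmatched and proposes to `w`, his favourite among the women who
have not rejected him yet. -/
def DAState.Proposes (P : Profile M W) (s : DAState M W) (m : M) (w : W) : Prop :=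
  s.Unmatched m ∧ (P.men m).IsFavourite {w' | ¬ s.rejected m w'} w

/-- The men among whom `w` chooses in the rejection phase: the current proposers and the man whose
proposal she holds. -/
def DAState.candidates (P : Profile M W) (s : DAState M W) (w : W) : Set M :=
  {m | s.Proposes P m w ∨ s.held w = some m}

/-- One round (proposal phase and rejection phase) of deferred acceptance: each woman tentatively
accepts her favourite candidate and rejects the other ones. -/
noncomputable def DAState.step (P : Profile M W) (s : DAState M W) : DAState M W where
  held := fun w => (P.women w).favourite (s.candidates P w)
  rejected := fun m w => s.rejected m w ∨
    (m ∈ s.candidates P w ∧ (P.women w).favourite (s.candidates P w) ≠ some m)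

/-- The state after `k` rounds. -/
noncomputable def DAState.after (P : Profile M W) : ℕ → DAState M W
  | 0 => DAState.init M W
  | k + 1 => (DAState.after P k).step P

/-- The algorithm has terminated: no further proposal can be made. -/
def DAState.Terminated (P : Profile M W) (s : DAState M W) : Prop :=
  ∀ m w, ¬ s.Proposes P m w

theorem PrefList.exists_isFavourite {α : Type u} [Finite α] (L : PrefList α) {S : Set α}
    (hS : S.Nonempty) : ∃ a, L.IsFavourite S a := by
  have := L.isStrictTotalOrder
  obtain ⟨a, ha, hmin⟩ :=
    (Finite.wellFounded_of_trans_of_irrefl L.prefers).has_min S hS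
  refine ⟨a, ha, fun b hb hne => ?_⟩
  rcases trichotomous_of L.prefers a b with h | h | h
  · exact h
  · exact absurd h.symm hne
  · exact absurd h (hmin b hb)

theorem PrefList.favourite_spec {α : Type u} {L : PrefList α} {S : Set α} {a : α}
    (h : L.favourite S = some a) : L.IsFavourite S a := by
  unfold PrefList.favourite at h
  split_ifs at h with h'
  cases h
  exact h'.choose_spec

theorem PrefList.exists_favourite {α : Type u} [Finite α] (L : PrefList α) {S : Set α}
    (hS : S.Nonempty) : ∃ a, L.favourite S = some a := by
  unfold PrefList.favourite
  exact ⟨_, dif_pos (L.exists_isFavourite hS)⟩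

/-- Invariants of a run: no man is held by two women; a woman who has rejected somebody holds a
proposal; a man held by a woman is unrejected by her and she is his favourite such woman. -/
structure DAState.Good (P : Profile M W) (s : DAState M W) : Prop where
  inj : ∀ w w' m, s.held w = some m → s.held w' = some m → w = w'
  busy : ∀ m w, s.rejected m w → ∃ m', s.held w = some m'
  fav : ∀ m w, s.held w = some m → (P.men m).IsFavourite {w' | ¬ s.rejected m w'} w

theorem PrefList.IsFavourite.unique {α : Type u} {L : PrefList α} {S : Set α} {a b : α}
    (ha : L.IsFavourite S a) (hb : L.IsFavourite S b) : a = b := by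
  have := L.isStrictTotalOrder
  by_contra hne
  exact asymm_of L.prefers (ha.2 b hb.1 (Ne.symm hne)) (hb.2 a ha.1 hne)

theorem DAState.Good.candidates_fav {P : Profile M W} {s : DAState M W} (hs : s.Good P)
    {m : M} {w : W} (h : m ∈ s.candidates P w) :
    (P.men m).IsFavourite {w' | ¬ s.rejected m w'} w := by
  rcases h with h | h
  · exact h.2
  · exact hs.fav m w h

theorem DAState.Good.step [Finite M] {P : Profile M W} {s : DAState M W} (hs : s.Good P) :
    (s.step P).Good P where
  inj w w' m h h' := (hs.candidates_fav (PrefList.favourite_spec h).1).unique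
    (hs.candidates_fav (PrefList.favourite_spec h').1)
  busy m w h := by
    apply PrefList.exists_favourite
    rcases h with h | h
    · obtain ⟨m', hm'⟩ := hs.busy m w h
      exact ⟨m', Or.inr hm'⟩
    · exact ⟨m, h.1⟩
  fav m w h := by
    have hf := hs.candidates_fav (PrefList.favourite_spec h).1
    refine ⟨?_, fun b hb hne => hf.2 b (fun hr => hb (Or.inl hr)) hne⟩
    rintro (hr | hr)
    · exact hf.1 hr
    · exact hr.2 h

theorem DAState.good_after [Finite M] (P : Profile M W) (k : ℕ) :
    (DAState.after P k).Good P := by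
  induction k with
  | zero =>
    exact { inj := fun w w' m h => nomatch h
            busy := fun m w h => False.elim h
            fav := fun m w h => nomatch h }
  | succ k ih => exact ih.step

/-- The pairs `(m, w)` such that `m` has proposed to `w` so far. -/
def DAState.proposed (s : DAState M W) : Set (M × W) :=
  {p | s.rejected p.1 p.2 ∨ s.held p.2 = some p.1}

theorem DAState.proposed_subset_step (P : Profile M W) (s : DAState M W) :
    s.proposed ⊆ (s.step P).proposed := by
  rintro ⟨m, w⟩ (h | h)
  · exact Or.inl (Or.inl h)
  · by_cases hw : (P.women w).favourite (s.candidates P w) = some m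
    · exact Or.inr hw
    · exact Or.inl (Or.inr ⟨Or.inr h, hw⟩)

theorem DAState.proposed_ssubset_step {P : Profile M W} {s : DAState M W}
    (h : ¬ s.Terminated P) : s.proposed ⊂ (s.step P).proposed := by
  unfold DAState.Terminated at h
  push Not at h
  obtain ⟨m, w, hp⟩ := h
  refine (Set.ssubset_iff_of_subset (s.proposed_subset_step P)).2 ⟨(m, w), ?_, ?_⟩
  · by_cases hw : (P.women w).favourite (s.candidates P w) = some m
    · exact Or.inr hw
    · exact Or.inl (Or.inr ⟨Or.inl hp, hw⟩)
  · rintro (h | h)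
    · exact hp.2.1 h
    · exact hp.1 w h

theorem DAState.step_of_terminated [Finite M] {P : Profile M W} {s : DAState M W}
    (h : s.Terminated P) : s.step P = s := by
  have hc : ∀ w, s.candidates P w = {m | s.held w = some m} := fun w => by
    ext m
    exact ⟨fun hm => hm.resolve_left (h m w), Or.inr⟩
  have hf : ∀ w, (P.women w).favourite (s.candidates P w) = s.held w := fun w => by
    rw [hc]
    cases hw : s.held w with
    | none =>
      cases hx : (P.women w).favourite {m | none = some m} with
      | none => rfl
      | some a => exact absurd (PrefList.favourite_spec hx).1 (by simp)
    | some m =>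
      obtain ⟨a, ha⟩ := (P.women w).exists_favourite (S := {m' | some m = some m'}) ⟨m, rfl⟩
      rw [ha]
      exact ((PrefList.favourite_spec ha).1 : some m = some a).symm
  have hh : (s.step P).held = s.held := funext hf
  have hr : (s.step P).rejected = s.rejected := by
    funext m w
    refine propext ⟨?_, Or.inl⟩
    rintro (hr | ⟨h1, h2⟩)
    · exact hr
    · rw [hf] at h2
      rw [hc] at h1
      exact absurd h1 h2
  cases s
  exact (congr (congrArg DAState.mk hh) hr)

/-- Deferred acceptance terminates within `|M| * |W|` rounds. -/
theorem DAState.terminated_after [Fintype M] [Fintype W] (P : Profile M W) :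
    (DAState.after P (Fintype.card M * Fintype.card W)).Terminated P := by
  have key : ∀ k, (DAState.after P k).Terminated P ∨
      k ≤ (DAState.after P k).proposed.ncard := by
    intro k
    induction k with
    | zero => exact Or.inr (Nat.zero_le _)
    | succ k ih =>
      by_cases ht : (DAState.after P k).Terminated P
      · left
        have : DAState.after P (k + 1) = DAState.after P k := DAState.step_of_terminated ht
        rwa [this]
      · right
        have h1 := ih.resolve_left ht
        have h2 : (DAState.after P k).proposed.ncard < (DAState.after P (k + 1)).proposed.ncard :=
          Set.ncard_lt_ncard (DAState.proposed_ssubset_step ht) (Set.toFinite _)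
        omega
  rcases key (Fintype.card M * Fintype.card W) with h | h
  · exact h
  · intro m w hp
    have h2 : (DAState.after P (Fintype.card M * Fintype.card W)).proposed.ncard
        < (Set.univ : Set (M × W)).ncard := by
      refine Set.ncard_lt_ncard ((Set.ssubset_iff_of_subset (Set.subset_univ _)).2
        ⟨(m, w), Set.mem_univ _, ?_⟩) (Set.toFinite _)
      rintro (hr | hr)
      · exact hp.2.1 hr
      · exact hp.1 w hr
    rw [Set.ncard_univ, Nat.card_eq_fintype_card, Fintype.card_prod] at h2
    omega

/-- The state in which deferred acceptance terminates. -/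
noncomputable def DAState.final [Fintype M] [Fintype W] (P : Profile M W) : DAState M W :=
  DAState.after P (Fintype.card M * Fintype.card W)

theorem DAState.final_man_matched [Fintype M] [Fintype W]
    (hcard : Fintype.card M = Fintype.card W) (P : Profile M W) (m : M) :
    ∃ w, (DAState.final P).held w = some m := by
  have hg : (DAState.final P).Good P := DAState.good_after P _
  have ht : (DAState.final P).Terminated P := DAState.terminated_after P
  by_contra hm
  have hu : (DAState.final P).Unmatched m := fun w hw => hm ⟨w, hw⟩
  have hall : ∀ w, (DAState.final P).rejected m w := by
    by_contra hne
    push Not at hne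
    obtain ⟨w, hw⟩ := (P.men m).exists_isFavourite
      (S := {w' | ¬ (DAState.final P).rejected m w'}) hne
    exact ht m w ⟨hu, hw⟩
  choose f hf using fun w => hg.busy m w (hall w)
  have hinj : Function.Injective f := fun a b hab =>
    hg.inj a b (f a) (hf a) (by rw [hab]; exact hf b)
  have hbij := (Fintype.bijective_iff_injective_and_card f).2 ⟨hinj, hcard.symm⟩
  obtain ⟨w, hw⟩ := hbij.2 m
  exact hm ⟨w, by rw [← hw]; exact hf w⟩

theorem DAState.final_bijective [Fintype M] [Fintype W]
    (hcard : Fintype.card M = Fintype.card W) (P : Profile M W) :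
    Function.Bijective fun m => (DAState.final_man_matched hcard P m).choose := by
  refine (Fintype.bijective_iff_injective_and_card _).2 ⟨fun a b hab => ?_, hcard⟩
  have ha := (DAState.final_man_matched hcard P a).choose_spec
  have hb := (DAState.final_man_matched hcard P b).choose_spec
  have hab' : (DAState.final_man_matched hcard P a).choose =
      (DAState.final_man_matched hcard P b).choose := hab
  rw [hab'] at ha
  exact Option.some.inj (ha.symm.trans hb)

/-- The matching computed by man-proposing deferred acceptance: man `m` is matched to the woman
who holds his proposal when the algorithm terminates. A matching is a bijection `μ : M ≃ W`;
`μ m` is the partner of man `m` and `μ.symm w` the partner of woman `w`. -/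
noncomputable def DA [Fintype M] [Fintype W] (hcard : Fintype.card M = Fintype.card W)
    (P : Profile M W) : M ≃ W :=
  Equiv.ofBijective _ (DAState.final_bijective hcard P)

/-- The defining property of `DA`. -/
theorem DA_spec [Fintype M] [Fintype W] (hcard : Fintype.card M = Fintype.card W)
    (P : Profile M W) (m : M) : (DAState.final P).held (DA hcard P m) = some m :=
  (DAState.final_man_matched hcard P m).choose_spec

end DA

section Manipulation

variable {M : Type u} {W : Type v}

/-- `(m, w)` blocks `μ` with respect to `P`: they prefer each other over their partners. -/
def Blocks (P : Profile M W) (μ : M ≃ W) (m : M) (w : W) : Prop :=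
  (P.men m).prefers w (μ m) ∧ (P.women w).prefers m (μ.symm w)

/-- `μ` is stable with respect to `P`: there is no blocking pair. -/
def Stable (P : Profile M W) (μ : M ≃ W) : Prop := ∀ m w, ¬ Blocks P μ m w

/-- All women weakly prefer `μ` over `μ'`, according to `P`. -/
def WomenWeaklyPrefer (P : Profile M W) (μ μ' : M ≃ W) : Prop :=
  ∀ w, (P.women w).weaklyPrefers (μ.symm w) (μ'.symm w)

variable [Fintype M] [Fintype W]

/-- Misreporting `L` causes no regret for man `m`: according to his true list, his match does not
worsen. -/
def NoRegret (hcard : Fintype.card M = Fintype.card W) (P : Profile M W) (m : M)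
    (L : PrefList W) : Prop :=
  (P.men m).weaklyPrefers (DA hcard (P.withMan m L) m) (DA hcard P m)

/-- `L` is an optimal one-for-all strategy of the accomplice `m` when the true profile is `P`.
The strategies of the accomplice are his no-regret lists. -/
def IsOptimalOneForAll (hcard : Fintype.card M = Fintype.card W) (P : Profile M W) (m : M)
    (L : PrefList W) : Prop :=
  NoRegret hcard P m L ∧
  WomenWeaklyPrefer P (DA hcard (P.withMan m L)) (DA hcard P) ∧
  ∀ L' : PrefList W, NoRegret hcard P m L' →
    WomenWeaklyPrefer P (DA hcard (P.withMan m L)) (DA hcard (P.withMan m L'))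

/-- The strategy `L` of man `m` is stability-preserving: the manipulated deferred acceptance
matching is stable with respect to the true preferences. -/
def StabilityPreserving (hcard : Fintype.card M = Fintype.card W) (P : Profile M W) (m : M)
    (L : PrefList W) : Prop :=
  Stable P (DA hcard (P.withMan m L))

end Manipulation

end OneForAll

/-! Truth-telling is optimal for `m`, so a list is no-regret exactly when it leaves his match `w₀`
unchanged. For such lists only the upper set, the women ranked above `w₀`, matters: a matching
giving him `w₀` is stable for a list iff no other man is in a blocking pair and none of these women
blocks with `m`. Enlarging the upper set while keeping `w₀` helps every woman: the new outcome is
stable for the old list, whose deferred acceptance outcome is the worst stable matching for the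
women.

Upper sets of no-regret lists are closed under union: the women's join of two outcomes is stable for
the union list, and strategy-proofness rules out a match above `w₀`
(`DA_withMan_of_upperSet_union`). Hence there is a greatest upper set, and its list is optimal. It
contains the true upper set, so its outcome is truly stable. All optimal strategies give the same
matching, by antisymmetry.

Man-optimality and strategy-proofness both come from the blocking lemma
`exists_blocks_of_prefers_DA`. -/

namespace OneForAll

/-! ### Preference lists and prescribed upper sets -/

namespace PrefList

variable {α : Type*} (L : PrefList α)

theorem irrefl (a : α) : ¬ L.prefers a a := by
  have := L.isStrictTotalOrder
  exact irrefl_of L.prefers a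

theorem trans {a b c : α} (h : L.prefers a b) (h' : L.prefers b c) : L.prefers a c := by
  have := L.isStrictTotalOrder
  exact trans_of L.prefers h h'

theorem asymm {a b : α} (h : L.prefers a b) : ¬ L.prefers b a :=
  fun h' => L.irrefl a (L.trans h h')

theorem trichotomy (a b : α) : L.prefers a b ∨ a = b ∨ L.prefers b a := by
  have := L.isStrictTotalOrder
  exact trichotomous_of L.prefers a b

theorem weaklyPrefers_of_not {a b : α} (h : ¬ L.prefers b a) : L.weaklyPrefers a b := by
  rcases L.trichotomy a b with h' | h' | h'
  exacts [Or.inl h', Or.inr h', absurd h' h]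

variable {L}

theorem prefers.trans_weakly {a b c : α} (h : L.prefers a b) (h' : L.weaklyPrefers b c) :
    L.prefers a c := by
  rcases h' with h' | rfl
  exacts [L.trans h h', h]

theorem weaklyPrefers.not_prefers {a b : α} (h : L.weaklyPrefers a b) : ¬ L.prefers b a := by
  rcases h with h | rfl
  exacts [L.asymm h, L.irrefl _]

theorem weaklyPrefers.antisymm {a b : α} (h : L.weaklyPrefers a b) (h' : L.weaklyPrefers b a) :
    a = b :=
  h.resolve_left h'.not_prefers

theorem IsFavourite.weaklyPrefers {S : Set α} {a b : α} (h : L.IsFavourite S a) (hb : b ∈ S) :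
    L.weaklyPrefers a b := by
  by_cases hab : b = a
  exacts [Or.inr hab.symm, Or.inl (h.2 b hb hab)]

/-- The list that ranks by `r` first (smaller is better) and breaks ties according to `L`. -/
def sortBy (L : PrefList α) (r : α → ℕ) : PrefList α where
  prefers a b := r a < r b ∨ (r a = r b ∧ L.prefers a b)
  isStrictTotalOrder :=
    { trichotomous := fun a b h h' => by
        push Not at h h'
        have hr : r a = r b := le_antisymm h'.1 h.1
        rcases L.trichotomy a b with h1 | h1 | h1
        exacts [absurd h1 (h.2 hr), h1, absurd h1 (h'.2 hr.symm)]
      irrefl := fun a h => h.elim (lt_irrefl _) fun h => L.irrefl a h.2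
      trans := fun a b c h h' => by
        rcases h with h | ⟨h, hL⟩ <;> rcases h' with h' | ⟨h', hL'⟩
        · exact Or.inl (h.trans h')
        · exact Or.inl (h' ▸ h)
        · exact Or.inl (h ▸ h')
        · exact Or.inr ⟨h.trans h', L.trans hL hL'⟩ }

theorem exists_upperSet_eq (L : PrefList α) {a : α} {U : Set α} (ha : a ∉ U) :
    ∃ L' : PrefList α, ∀ b, L'.prefers b a ↔ b ∈ U := by
  classical
  refine ⟨L.sortBy fun b => if b ∈ U then 0 else if b = a then 1 else 2, fun b => ?_⟩
  by_cases hb : b ∈ U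
  · simp [sortBy, ha, hb]
  · by_cases hba : b = a
    · subst hba
      simp [sortBy, hb, L.irrefl]
    · simp [sortBy, ha, hb, hba]

end PrefList

/-! ### Changing one man's list -/

section WithMan

variable {M W : Type*} (P : Profile M W) (m : M)

theorem Profile.withMan_men_self (L : PrefList W) : (P.withMan m L).men m = L := by
  simp [Profile.withMan]

theorem Profile.withMan_men_of_ne {x : M} (h : x ≠ m) (L : PrefList W) :
    (P.withMan m L).men x = P.men x := by
  simp [Profile.withMan, h]

theorem Profile.withMan_withMan (L L' : PrefList W) :
    (P.withMan m L).withMan m L' = P.withMan m L' := by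
  simp [Profile.withMan]

theorem Profile.withMan_self : P.withMan m (P.men m) = P := by
  simp [Profile.withMan]

variable {P m}

/-- Stability survives when `m` ranks fewer women above his partner. -/
theorem Stable.of_withMan {L L' : PrefList W} {ν : M ≃ W} (h : Stable (P.withMan m L') ν)
    (hL : ∀ w, L.prefers w (ν m) → L'.prefers w (ν m)) : Stable (P.withMan m L) ν := by
  rintro x w ⟨h1, h2⟩
  refine h x w ⟨?_, h2⟩
  by_cases hx : x = m
  · subst hx
    rw [Profile.withMan_men_self] at h1 ⊢
    exact hL w h1
  · rwa [Profile.withMan_men_of_ne _ _ hx] at h1 ⊢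

end WithMan

/-! ### Deferred acceptance, the blocking lemma and the join of stable matchings -/

section DA

variable {M W : Type*}

/-- A woman's held man only improves: whoever she holds is a candidate again in the next round. -/
theorem DAState.exists_held_prefers [Finite M] (P : Profile M W) (k : ℕ) {m : M} {w : W}
    (h : (DAState.after P k).rejected m w) :
    ∃ m', (DAState.after P k).held w = some m' ∧ (P.women w).prefers m' m := by
  induction k with
  | zero => exact h.elim
  | succ k ih =>
    rcases h with h | ⟨hc, hne⟩
    · obtain ⟨m₁, h₁, hp⟩ := ih h
      have hc : m₁ ∈ (DAState.after P k).candidates P w := Or.inr h₁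
      obtain ⟨a, ha⟩ := (P.women w).exists_favourite ⟨m₁, hc⟩
      refine ⟨a, ha, ?_⟩
      rcases (PrefList.favourite_spec ha).weaklyPrefers hc with h' | rfl
      exacts [(P.women w).trans h' hp, hp]
    · obtain ⟨a, ha⟩ := (P.women w).exists_favourite ⟨m, hc⟩
      refine ⟨a, ha, ((PrefList.favourite_spec ha).weaklyPrefers hc).resolve_right ?_⟩
      rintro rfl
      exact hne ha

theorem DAState.rejected_of_prefers [Finite M] (P : Profile M W) (k : ℕ) {m : M} {w w' : W}
    (hw : (DAState.after P k).held w = some m) (h : (P.men m).prefers w' w) :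
    (DAState.after P k).rejected m w' := by
  by_contra hr
  exact (((DAState.good_after P k).fav m w hw).weaklyPrefers hr).not_prefers h

theorem DAState.rejected_mono {P : Profile M W} {k l : ℕ} (hkl : k ≤ l) {m : M} {w : W}
    (h : (DAState.after P k).rejected m w) : (DAState.after P l).rejected m w := by
  induction hkl with
  | refl => exact h
  | step _ ih => exact Or.inl ih

theorem DAState.after_eq_final [Fintype M] [Fintype W] (P : Profile M W) {k : ℕ}
    (hk : Fintype.card M * Fintype.card W ≤ k) : DAState.after P k = DAState.final P := by
  induction hk with
  | refl => rfl
  | step _ ih =>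
    rw [DAState.after, ih]
    exact DAState.step_of_terminated (DAState.terminated_after P)

theorem DAState.rejected_final [Fintype M] [Fintype W] {P : Profile M W} {k : ℕ} {m : M} {w : W}
    (h : (DAState.after P k).rejected m w) : (DAState.final P).rejected m w := by
  rw [← DAState.after_eq_final P (le_max_left _ k)]
  exact DAState.rejected_mono (le_max_right _ k) h

variable [Fintype M] [Fintype W] (hcard : Fintype.card M = Fintype.card W) (P : Profile M W)

theorem DA_stable : Stable P (DA hcard P) := by
  rintro m w ⟨h1, h2⟩
  obtain ⟨m', hm', hp⟩ := DAState.exists_held_prefers P _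
    (DAState.rejected_of_prefers P _ (DA_spec hcard P m) h1)
  have h3 := DA_spec hcard P ((DA hcard P).symm w)
  rw [Equiv.apply_symm_apply] at h3
  rw [Option.some.inj (h3.symm.trans hm')] at h2
  exact (P.women w).asymm h2 hp

variable {P}

/-- The blocking lemma: if some men prefer `ν` over the deferred acceptance matching, then `ν` is
blocked by a pair whose man is not one of them. -/
theorem exists_blocks_of_prefers_DA {ν : M ≃ W} {m : M}
    (hm : (P.men m).prefers (ν m) (DA hcard P m)) :
    ∃ x w, ¬ (P.men x).prefers (ν x) (DA hcard P x) ∧ Blocks P ν x w := by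
  classical
  set μ := DA hcard P
  let S : Set M := {x | (P.men x).prefers (ν x) (μ x)}
  by_cases hsub : ∀ x ∈ S, μ.symm (ν x) ∈ S
  -- `μ.symm ∘ ν` is injective and maps the finite set `S` into itself, so it permutes `S`.
  · have hsurj : ∀ x ∈ S, ∃ y ∈ S, ν y = μ x := by
      intro x hx
      have hinj : Set.InjOn (fun y => μ.symm (ν y)) S :=
        (μ.symm.injective.comp ν.injective).injOn
      obtain ⟨y, hy, hyx⟩ := (Set.eq_of_subset_of_ncard_le (Set.image_subset_iff (t := S).2 hsub)
        hinj.ncard_image.ge).ge hx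
      exact ⟨y, hy, (Equiv.symm_apply_eq μ).1 hyx⟩
    have hex : ∃ k, ∀ x ∈ S, (DAState.after P k).held (μ x) = some x :=
      ⟨_, fun x _ => DA_spec hcard P x⟩
    -- Round `k + 1` is the first after which every man of `S` is held by his final partner; `x` is
    -- one who arrives in that round.
    obtain ⟨k, hk, hlast⟩ : ∃ k, (∀ x ∈ S, (DAState.after P (k + 1)).held (μ x) = some x) ∧
        ∃ x ∈ S, (DAState.after P k).held (μ x) ≠ some x := by
      have hspec := Nat.find_spec hex
      have hmin := fun j => Nat.find_min hex (m := j)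
      cases hn : Nat.find hex with
      | zero =>
        rw [hn] at hspec
        exact nomatch hspec m hm
      | succ k =>
        rw [hn] at hspec hmin
        have := hmin k (Nat.lt_succ_self k)
        push Not at this
        exact ⟨k, hspec, this⟩
    obtain ⟨x, hx, hxk⟩ := hlast
    obtain ⟨y, hy, hyx⟩ := hsurj x hx
    have hg := DAState.good_after P k
    have hcand : ∀ z ∈ S, z ∈ (DAState.after P k).candidates P (μ z) :=
      fun z hz => (PrefList.favourite_spec (hk z hz)).1
    have hyp : (P.men y).prefers (μ x) (μ y) := hyx ▸ hy
    -- The rejection cannot fall in round `k + 1` itself, since in that round `y` is a candidate of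
    -- `μ y` only.
    have hyr : (DAState.after P k).rejected y (μ x) := by
      refine (DAState.rejected_of_prefers P (k + 1) (hk y hy) hyp).resolve_right fun h => ?_
      have := (hg.candidates_fav h.1).unique (hg.candidates_fav (hcand y hy))
      rw [this] at hyp
      exact (P.men y).irrefl _ hyp
    obtain ⟨z, hz, hzy⟩ := DAState.exists_held_prefers P k hyr
    have hzx : z ≠ x := fun h => hxk (h ▸ hz)
    have hzS : z ∉ S := fun hzS => by
      have := (hg.candidates_fav (Or.inr hz)).unique (hg.candidates_fav (hcand z hzS))
      exact hzx (μ.injective this.symm)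
    -- After round `k`, `z` is held by `μ x`, while `μ z` never rejects him; so `μ x` is his
    -- favourite of the two.
    have hzw : (P.men z).prefers (μ x) (μ z) := by
      refine ((hg.fav z _ hz).weaklyPrefers fun hr => ?_).resolve_right
        fun h => hzx (μ.injective h.symm)
      exact ((DAState.good_after P _).fav z _ (DA_spec hcard P z)).1 (DAState.rejected_final hr)
    refine ⟨z, μ x, hzS, hzw.trans_weakly ((P.men z).weaklyPrefers_of_not hzS), ?_⟩
    rwa [← hyx, Equiv.symm_apply_apply, hyx]
  -- Now some `y ∈ S` takes in `ν` a woman whose `μ`-partner is outside `S`. She prefers that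
  -- partner, as otherwise she and `y` would block `μ`; so these two block `ν`.
  · push Not at hsub
    obtain ⟨y, hy, hyS⟩ := hsub
    refine ⟨μ.symm (ν y), ν y, hyS, ?_, ?_⟩
    · have h := (P.men (μ.symm (ν y))).weaklyPrefers_of_not hyS
      rw [Equiv.apply_symm_apply] at h
      refine h.resolve_right fun h => hyS ?_
      rwa [← ν.injective h]
    · rw [Equiv.symm_apply_apply]
      refine ((P.women (ν y)).weaklyPrefers_of_not fun h => ?_).resolve_right fun h => hyS ?_
      · exact DA_stable hcard P y (ν y) ⟨hy, h⟩
      · rwa [h]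

theorem Stable.DA_weaklyPrefers {ν : M ≃ W} (hν : Stable P ν) (m : M) :
    (P.men m).weaklyPrefers (DA hcard P m) (ν m) :=
  (P.men m).weaklyPrefers_of_not fun h =>
    let ⟨x, w, _, hb⟩ := exists_blocks_of_prefers_DA hcard h
    hν x w hb

theorem Stable.womenWeaklyPrefer_DA {ν : M ≃ W} (hν : Stable P ν) :
    WomenWeaklyPrefer P ν (DA hcard P) := by
  refine fun w => (P.women w).weaklyPrefers_of_not fun h => ?_
  refine hν ((DA hcard P).symm w) w ⟨?_, h⟩
  have h1 := hν.DA_weaklyPrefers hcard ((DA hcard P).symm w)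
  rw [Equiv.apply_symm_apply] at h1
  refine h1.resolve_right fun h2 => ?_
  rw [(Equiv.eq_symm_apply ν).2 h2.symm] at h
  exact (P.women w).irrefl _ h

variable (P) in
/-- Men-proposing deferred acceptance is strategy-proof for the men. -/
theorem DA_strategyproof (m : M) (L : PrefList W) :
    (P.men m).weaklyPrefers (DA hcard P m) (DA hcard (P.withMan m L) m) := by
  refine (P.men m).weaklyPrefers_of_not fun h => ?_
  obtain ⟨x, w, hx, hb⟩ := exists_blocks_of_prefers_DA hcard h
  -- The man of the blocking pair does not gain, so he is not `m` and his list is the same in both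
  -- profiles.
  refine DA_stable hcard (P.withMan m L) x w ⟨?_, hb.2⟩
  rw [Profile.withMan_men_of_ne]
  · exact hb.1
  · rintro rfl
    exact hx h

/-- Two stable matchings have a common upper bound for the women, in which every man gets one of
his two partners. -/
theorem Stable.exists_join (hcard : Fintype.card M = Fintype.card W) {μ ν : M ≃ W} (hμ : Stable P μ) (hν : Stable P ν) :
    ∃ σ : M ≃ W, (∀ m, σ m = μ m ∨ σ m = ν m) ∧ WomenWeaklyPrefer P σ μ ∧
      WomenWeaklyPrefer P σ ν := by
  classical
  let f : W → M := fun w =>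
    if (P.women w).prefers (μ.symm w) (ν.symm w) then μ.symm w else ν.symm w
  have hf : ∀ w, (f w = μ.symm w ∧ (P.women w).prefers (μ.symm w) (ν.symm w)) ∨
      (f w = ν.symm w ∧ ¬ (P.women w).prefers (μ.symm w) (ν.symm w)) := by
    intro w
    by_cases h : (P.women w).prefers (μ.symm w) (ν.symm w) <;> simp [f, h]
  -- If two women chose the same man from different matchings, he and the woman he prefers would
  -- block the matching in which he has the other.
  have key : ∀ w w', μ.symm w = ν.symm w' → (P.women w).prefers (μ.symm w) (ν.symm w) →
      ¬ (P.women w').prefers (μ.symm w') (ν.symm w') → w = w' := by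
    intro w w' h hw hw'
    by_contra hne
    have h1 : μ (μ.symm w) = w := μ.apply_symm_apply w
    have h2 : ν (μ.symm w) = w' := by rw [h, ν.apply_symm_apply]
    rcases (P.men (μ.symm w)).trichotomy w w' with h3 | h3 | h3
    · exact hν (μ.symm w) w ⟨by rwa [h2], hw⟩
    · exact hne h3
    · refine hμ (μ.symm w) w' ⟨by rwa [h1], ?_⟩
      rw [h]
      refine ((P.women w').weaklyPrefers_of_not hw').resolve_right fun h4 => ?_
      exact hne (μ.symm.injective (h.trans h4))
  have hinj : Function.Injective f := by
    intro w w' h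
    rcases hf w with ⟨h1, h2⟩ | ⟨h1, h2⟩ <;> rcases hf w' with ⟨h3, h4⟩ | ⟨h3, h4⟩ <;>
      rw [h1, h3] at h
    · exact μ.symm.injective h
    · exact key w w' h h2 h4
    · exact (key w' w h.symm h4 h2).symm
    · exact ν.symm.injective h
  have hbij := (Fintype.bijective_iff_injective_and_card f).2 ⟨hinj, hcard.symm⟩
  refine ⟨(Equiv.ofBijective f hbij).symm, fun m => ?_, fun w => ?_, fun w => ?_⟩
  · obtain ⟨w, rfl⟩ := hbij.2 m
    have h1 : (Equiv.ofBijective f hbij).symm (f w) = w :=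
      Equiv.ofBijective_symm_apply_apply f hbij w
    rw [h1]
    rcases hf w with h | h
    · exact Or.inl (by rw [h.1, Equiv.apply_symm_apply])
    · exact Or.inr (by rw [h.1, Equiv.apply_symm_apply])
  · change (P.women w).weaklyPrefers (f w) _
    rcases hf w with h | h
    · exact Or.inr h.1
    · rw [h.1]
      exact (P.women w).weaklyPrefers_of_not h.2
  · change (P.women w).weaklyPrefers (f w) _
    rcases hf w with h | h
    · rw [h.1]
      exact Or.inl h.2
    · exact Or.inr h.1

end DA

/-! ### No-regret misreports and their upper sets -/

section Manipulation

variable {M W : Type*}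

theorem WomenWeaklyPrefer.antisymm {P : Profile M W} {μ ν : M ≃ W}
    (h : WomenWeaklyPrefer P μ ν) (h' : WomenWeaklyPrefer P ν μ) : μ = ν :=
  Equiv.symm_bijective.injective (Equiv.ext fun w => (h w).antisymm (h' w))

variable [Fintype M] [Fintype W] (hcard : Fintype.card M = Fintype.card W) {P : Profile M W}
  {m : M}

theorem noRegret_iff {L : PrefList W} :
    NoRegret hcard P m L ↔ DA hcard (P.withMan m L) m = DA hcard P m :=
  ⟨fun h => h.antisymm (DA_strategyproof hcard P m L), Or.inr⟩

/-- If `L'` leaves the match of `m` unchanged and ranks more women above it than `L` does, then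
all women weakly prefer the outcome of `L'`. -/
theorem womenWeaklyPrefer_of_upperSet_subset {L L' : PrefList W} {w₀ : W}
    (hL' : DA hcard (P.withMan m L') m = w₀)
    (hsub : ∀ w, L.prefers w w₀ → L'.prefers w w₀) :
    WomenWeaklyPrefer P (DA hcard (P.withMan m L')) (DA hcard (P.withMan m L)) := by
  refine Stable.womenWeaklyPrefer_DA (P := P.withMan m L) hcard ?_
  exact (DA_stable hcard (P.withMan m L')).of_withMan (by rwa [hL'])

/-- A list ranking exactly the women above `w₀` that `L₁` or `L₂` ranks above `w₀` still matches
`m` to `w₀`. -/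
theorem DA_withMan_of_upperSet_union {L₁ L₂ L : PrefList W} {w₀ : W}
    (h₁ : DA hcard (P.withMan m L₁) m = w₀) (h₂ : DA hcard (P.withMan m L₂) m = w₀)
    (hL : ∀ w, L.prefers w w₀ ↔ L₁.prefers w w₀ ∨ L₂.prefers w w₀) :
    DA hcard (P.withMan m L) m = w₀ := by
  -- `T` puts `w₀` first, so `m` blocks nothing: both outcomes are stable for this common profile
  -- and have a join.
  obtain ⟨T, hT⟩ := L₁.exists_upperSet_eq (a := w₀) (Set.notMem_empty w₀)
  have hs : ∀ L', DA hcard (P.withMan m L') m = w₀ →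
      Stable (P.withMan m T) (DA hcard (P.withMan m L')) := fun L' h' =>
    (DA_stable hcard (P.withMan m L')).of_withMan fun w hw =>
      ((hT w).1 (by rwa [h'] at hw)).elim
  obtain ⟨σ, hσ, hσ₁, hσ₂⟩ := (hs L₁ h₁).exists_join hcard (hs L₂ h₂)
  have hσm : σ m = w₀ := by
    rcases hσ m with h | h
    exacts [h.trans h₁, h.trans h₂]
  have hblock : ∀ L', (∀ w, ((P.withMan m L').women w).weaklyPrefers (σ.symm w)
      ((DA hcard (P.withMan m L')).symm w)) → ∀ x w, (P.women w).prefers x (σ.symm w) →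
      ¬ ((P.withMan m L').men x).prefers w (DA hcard (P.withMan m L') x) :=
    fun L' h' x w hw hx => DA_stable hcard (P.withMan m L') x w ⟨hx, hw.trans_weakly (h' w)⟩
  -- Women are at least as well off in `σ` as in either outcome, so a pair blocking `σ` would block
  -- one of the two outcomes.
  have hst : Stable (P.withMan m L) σ := by
    rintro x w ⟨hx, hw⟩
    have b₁ := hblock L₁ hσ₁ x w hw
    have b₂ := hblock L₂ hσ₂ x w hw
    by_cases hxm : x = m
    · subst hxm
      rw [Profile.withMan_men_self, hσm, hL] at hx
      rw [Profile.withMan_men_self, h₁] at b₁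
      rw [Profile.withMan_men_self, h₂] at b₂
      exact hx.elim b₁ b₂
    · rw [Profile.withMan_men_of_ne _ _ hxm] at hx b₁ b₂
      rcases hσ x with h | h <;> rw [h] at hx
      exacts [b₁ hx, b₂ hx]
  have hopt := hst.DA_weaklyPrefers hcard m
  rw [Profile.withMan_men_self, hσm] at hopt
  -- Otherwise `m`, with `L'` as true list, would gain by reporting `L`.
  have hsp : ∀ L', DA hcard (P.withMan m L') m = w₀ →
      ¬ L'.prefers (DA hcard (P.withMan m L) m) w₀ := by
    intro L' h' hlt
    have h := DA_strategyproof hcard (P.withMan m L') m L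
    rw [Profile.withMan_men_self, Profile.withMan_withMan, h'] at h
    exact h.not_prefers hlt
  exact hopt.resolve_left fun h => ((hL _).1 h).elim (hsp L₁ h₁) (hsp L₂ h₂)

variable (P m)

/-- Some no-regret list ranks above the match of `m` every woman that any no-regret list does. -/
theorem exists_noRegret_upperSet_max :
    ∃ L : PrefList W, DA hcard (P.withMan m L) m = DA hcard P m ∧
      ∀ L' : PrefList W, DA hcard (P.withMan m L') m = DA hcard P m →
        ∀ w, L'.prefers w (DA hcard P m) → L.prefers w (DA hcard P m) := by
  set w₀ := DA hcard P m
  let 𝒰 : Set (Set W) := {U | ∃ L : PrefList W, DA hcard (P.withMan m L) m = w₀ ∧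
    {w | L.prefers w w₀} = U}
  have hne : 𝒰.Nonempty := ⟨_, P.men m, by rw [Profile.withMan_self], rfl⟩
  obtain ⟨U, ⟨L, hL, rfl⟩, hmax⟩ := (Set.toFinite 𝒰).exists_maximal hne
  refine ⟨L, hL, fun L' hL' w hw => ?_⟩
  obtain ⟨K, hK⟩ := L.exists_upperSet_eq (a := w₀)
    (U := {w | L.prefers w w₀} ∪ {w | L'.prefers w w₀})
    (by rintro (h | h); exacts [L.irrefl _ h, L'.irrefl _ h])
  have hKm : DA hcard (P.withMan m K) m = w₀ := DA_withMan_of_upperSet_union hcard hL hL' hK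
  -- Closure under union makes a maximal upper set the greatest one.
  exact hmax ⟨K, hKm, rfl⟩ (fun v hv => (hK v).2 (Or.inl hv)) ((hK w).2 (Or.inr hw))

/-- An optimal one-for-all strategy whose outcome is stable for the true preferences. -/
theorem exists_optimal_stabilityPreserving :
    ∃ L : PrefList W, IsOptimalOneForAll hcard P m L ∧ StabilityPreserving hcard P m L := by
  obtain ⟨L, hL, hmax⟩ := exists_noRegret_upperSet_max hcard P m
  have hself := P.withMan_self m
  have htrue : DA hcard (P.withMan m (P.men m)) m = DA hcard P m := by rw [hself]
  refine ⟨L, ⟨Or.inr hL, ?_, fun L' hL' => ?_⟩, ?_⟩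
  · have := womenWeaklyPrefer_of_upperSet_subset hcard hL (hmax _ htrue)
    rwa [hself] at this
  · exact womenWeaklyPrefer_of_upperSet_subset hcard hL (hmax L' ((noRegret_iff hcard).1 hL'))
  -- The true list is no-regret, so `L` ranks above the match every woman that `m` truly does.
  · have := (DA_stable hcard (P.withMan m L)).of_withMan (L := P.men m)
      (by rw [hL]; exact hmax _ htrue)
    rwa [hself] at this

variable {P m}

theorem IsOptimalOneForAll.DA_eq {L L' : PrefList W} (h : IsOptimalOneForAll hcard P m L)
    (h' : IsOptimalOneForAll hcard P m L') :
    DA hcard (P.withMan m L) = DA hcard (P.withMan m L') :=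
  (h.2.2 L' h'.1).antisymm (h'.2.2 L h.1)


end Manipulation

end OneForAll

theorem mainTheorem7 {M : Type*} {W : Type*} [Fintype M] [Fintype W]
    (hcard : Fintype.card M = Fintype.card W) (P : OneForAll.Profile M W) (m : M) :
    (∃ L : OneForAll.PrefList W, OneForAll.IsOptimalOneForAll hcard P m L) ∧
    ∀ L : OneForAll.PrefList W, OneForAll.IsOptimalOneForAll hcard P m L →
      OneForAll.StabilityPreserving hcard P m L := by
  obtain ⟨L, hL, hstab⟩ := OneForAll.exists_optimal_stabilityPreserving hcard P m
  refine ⟨⟨L, hL⟩, fun L' hL' => ?_⟩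
  rw [OneForAll.StabilityPreserving, hL'.DA_eq hcard hL]
  exact hstab
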